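/- Let $p$ be a prime, $F$ a non-archimedean local field with residue characteristic $p$ (of any characteristic), $\mathcal O$ its ring of integers, $\varpi$ a uniformizer, and $k$ an algebraically closed field of characteristic $p$. Let $G=\mathrm{GL}_2(F)$, $K=\mathrm{GL}_2(\mathcal O)$, and let $Z$ be the centre of $G$. Let $\pi$ be a smooth representation of $G$ over $k$ with a central character, finitely generated as a $k[G]$-module. Let $\mathcal W(\pi)$ be the set of finite-dimensional $KZ$-stable subspaces $W\subset\pi$ that generate $\pi$ as a $k[G]$-module. For $W\in\mathcal W(\pi)$, let $\mathrm{c\text{-}Ind}_{KZ}^G W$ be the space of locally constant functions $f:G\to W$ with compact support modulo $KZ$ such that $f(hg)=h\cdot f(g)$ for $h\in KZ$, $g\in G$, on which $G$ acts by $(g'f)(g)=f(gg')$. For $g\in G$ and $w\in W$ let $[g,w]$ be its element supported on $KZg^{-1}$ with value $w$ at $g^{-1}$. Let $R(W,\pi)$ be the kernel of the surjective $G$-equivariant map $\mathrm{c\text{-}Ind}_{KZ}^G W\to\pi$, $[g,w]\mapsto g w$. This map is called a finite presentation of $\pi$ if $R(W,\pi)$ is finitely generated as a $k[G]$-module; it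 is called a standard presentation of $\pi$ if $R(W,\pi)$ is generated as a $k[G]$-module by the elements $$[\alpha,x]-[1,\alpha x],\qquad x\in W\cap\alpha^{-1}W,\qquad \alpha=\begin{pmatrix}\varpi&0\\0&1\end{pmatrix}.$$ We say that $\pi$ admits a finite (resp. standard) presentation if for some $W\in\mathcal W(\pi)$ the map $\mathrm{c\text{-}Ind}_{KZ}^G W\to\pi$ is a finite (resp. standard) presentation of $\pi$. Then: 1. $\pi$ admits a finite presentation if and only if $\pi$ admits a standard presentation. 2. $\pi$ admits a finite presentation if and only if, for every $W\in\mathcal W(\pi)$, the map $\mathrm{c\text{-}Ind}_{KZ}^G W\to\pi$ is a finite presentation. -/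

import Mathlib

open scoped ValuativeRel Pointwise

noncomputable section

namespace ModPRep

section General

variable {k G V : Type*} [Field k] [Group G] [AddCommGroup V] [Module k V]

/-- The subspace `⟨G · S⟩` spanned by the `G`-translates of the elements of `S`, i.e. the
`k[G]`-submodule generated by `S`. -/
def gspan (ρ : Representation k G V) (S : Set V) : Submodule k V :=
  Submodule.span k {v | ∃ g : G, ∃ s ∈ S, v = ρ g s}

/-- The subspace `R` is finitely generated as a `k[G]`-submodule. -/
def IsFinGen (ρ : Representation k G V) (R : Submodule k V) : Prop :=
  ∃ S : Set V, S.Finite ∧ gspan ρ S = R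

/-- The centre of `G` acts through a character. -/
def HasCentralCharacter (ρ : Representation k G V) : Prop :=
  ∃ χ : Subgroup.center G →* kˣ, ∀ (z : Subgroup.center G) (v : V),
    ρ (z : G) v = (χ z : k) • v

/-- Restriction of a representation to a subgroup. -/
abbrev res (ρ : Representation k G V) (H : Subgroup G) : Representation k H V :=
  ρ.comp H.subtype

variable [TopologicalSpace G]

/-- A representation is smooth if every vector is fixed by an open subgroup. -/
class IsSmooth (ρ : Representation k G V) : Prop where
  exists_open : ∀ v : V, ∃ U : Subgroup G, IsOpen (U : Set G) ∧ ∀ g ∈ U, ρ g v = v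

instance isSmooth_res (ρ : Representation k G V) [IsSmooth ρ] (H : Subgroup G) :
    IsSmooth (res ρ H) where
  exists_open v := by
    obtain ⟨U, hU, h⟩ := IsSmooth.exists_open (ρ := ρ) v
    exact ⟨U.subgroupOf H, hU.preimage continuous_subtype_val, fun g hg => h g hg⟩

instance isSmooth_sub (ρ : Representation k G V) [IsSmooth ρ] (W : Subrepresentation ρ) :
    IsSmooth W.toRepresentation where
  exists_open v := by
    obtain ⟨U, hU, h⟩ := IsSmooth.exists_open (ρ := ρ) (v : V)
    exact ⟨U, hU, fun g hg => Subtype.ext (h g hg)⟩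

end General

section CompactInduction

variable {k G M : Type*} [Field k] [Group G] [TopologicalSpace G] [IsTopologicalGroup G]
  [AddCommGroup M] [Module k M] {H : Subgroup G}

/-- The space of the compact induction of the representation `σ` of `H`: locally constant
functions `f : G → M` with compact support modulo `H` such that `f (h g) = h · f g`. -/
def cInd (σ : Representation k H M) : Submodule k (G → M) where
  carrier := {f | IsLocallyConstant f ∧
    (∃ C : Set G, IsCompact C ∧ Function.support f ⊆ (H : Set G) * C) ∧
    ∀ (h : H) (g : G), f (h * g) = σ h (f g)}
  zero_mem' := ⟨IsLocallyConstant.const 0, ⟨∅, isCompact_empty, by simp⟩, by simp⟩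
  add_mem' := by
    rintro f f' ⟨h1, ⟨C, hC, hs⟩, h3⟩ ⟨h1', ⟨C', hC', hs'⟩, h3'⟩
    refine ⟨h1.add h1', ⟨C ∪ C', hC.union hC', ?_⟩, fun h g => by simp [h3, h3']⟩
    refine (Function.support_add f f').trans ?_
    rw [Set.mul_union]
    exact Set.union_subset_union hs hs'
  smul_mem' := by
    rintro c f ⟨h1, ⟨C, hC, hs⟩, h3⟩
    exact ⟨h1.comp (c • ·), ⟨C, hC, (Function.support_const_smul_subset c f).trans hs⟩,
      fun h g => by simp [h3]⟩

/-- The action `(g' · f) g = f (g g')` of `G` on the compact induction. -/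
def cIndRep (σ : Representation k H M) : Representation k G (cInd σ) where
  toFun g' :=
    { toFun := fun f => ⟨fun g => f.1 (g * g'), by
        obtain ⟨f, h1, ⟨C, hC, hs⟩, h3⟩ := f
        refine ⟨h1.comp_continuous (continuous_mul_const g'),
          ⟨C * {g'⁻¹}, hC.mul isCompact_singleton, ?_⟩, fun h g => ?_⟩
        · intro g hg
          obtain ⟨h, hh, c, hc, e⟩ := hs (show g * g' ∈ Function.support f from hg)
          exact ⟨h, hh, c * g'⁻¹, Set.mul_mem_mul hc rfl, by
            change h * (c * g'⁻¹) = g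
            rw [← mul_assoc, show h * c = g * g' from e, mul_inv_cancel_right]⟩
        · simpa [mul_assoc] using h3 h (g * g')⟩
      map_add' := fun _ _ => rfl
      map_smul' := fun _ _ => rfl }
  map_one' := by ext f; simp
  map_mul' a b := by ext f; simp [mul_assoc]

open Classical in
/-- The function `[g, v]` with support in `H g⁻¹` and value `v` at `g⁻¹`, as an element of the
compact induction of a smooth representation of an open subgroup. -/
def bracket (hH : IsOpen (H : Set G)) (σ : Representation k H M) [IsSmooth σ] (g : G) (v : M) :
    cInd σ :=
  ⟨fun x => if hx : x * g ∈ H then σ ⟨x * g, hx⟩ v else 0, by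
    have key : ∀ (h : H) (x : G),
        (if hx : (h : G) * x * g ∈ H then σ ⟨h * x * g, hx⟩ v else 0) =
          σ h (if hx : x * g ∈ H then σ ⟨x * g, hx⟩ v else 0) := by
      intro h x
      by_cases hx : x * g ∈ H
      · have hx' : (h : G) * x * g ∈ H := by rw [mul_assoc]; exact H.mul_mem h.2 hx
        rw [dif_pos hx, dif_pos hx', ← Module.End.mul_apply, ← map_mul]
        exact congrArg (fun a : H => σ a v) (Subtype.ext (mul_assoc (h : G) x g))
      · have hx' : (h : G) * x * g ∉ H := by
          rw [mul_assoc, H.mul_mem_cancel_left h.2]; exact hx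
        rw [dif_neg hx, dif_neg hx', map_zero]
    refine ⟨?_, ⟨{g⁻¹}, isCompact_singleton, ?_⟩, key⟩
    · rw [IsLocallyConstant.iff_exists_open]
      intro x
      obtain ⟨U, hU, hfix⟩ := IsSmooth.exists_open (ρ := σ)
        (if hx : x * g ∈ H then σ ⟨x * g, hx⟩ v else 0)
      refine ⟨(fun y => y * x⁻¹) ⁻¹' (Subtype.val '' (U : Set H)),
        (hH.isOpenMap_subtype_val _ hU).preimage (continuous_mul_const _), ?_, ?_⟩
      · exact ⟨1, U.one_mem, by simp⟩
      · rintro y ⟨u, hu, e⟩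
        have hy : y = (u : G) * x := by
          have e' : (u : G) = y * x⁻¹ := e
          rw [e']; group
        rw [hy]
        exact (key u x).trans (hfix u hu)
    · intro x hx
      have hxH : x * g ∈ H := by
        by_contra hn
        exact hx (dif_neg hn)
      exact ⟨x * g, hxH, g⁻¹, rfl, by simp⟩⟩

variable {V : Type*} [AddCommGroup V] [Module k V]

theorem frobenius_support_finite (hH : IsOpen (H : Set G)) (ρ : Representation k G V)
    (W : Subrepresentation (res ρ H)) (f : cInd W.toRepresentation) :
    (Function.support fun q : G ⧸ H => ρ q.out ((f.1 q.out⁻¹ : W.toSubmodule) : V)).Finite := by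
  obtain ⟨f, h1, ⟨C, hC, hs⟩, h3⟩ := f
  have hd : DiscreteTopology (G ⧸ H) := QuotientGroup.discreteTopology hH
  have hfin : ((fun g : G => (g : G ⧸ H)) '' C⁻¹).Finite :=
    (hC.inv.image QuotientGroup.continuous_mk).finite_of_discrete
  refine hfin.subset fun q hq => ?_
  have hq' : q.out⁻¹ ∈ Function.support f := by
    intro h0
    exact hq (by simp [h0])
  obtain ⟨h, hh, c, hc, e⟩ := hs hq'
  refine ⟨c⁻¹, Set.inv_mem_inv.mpr hc, ?_⟩
  have e' : q.out = c⁻¹ * h⁻¹ := by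
    have : (h * c)⁻¹ = q.out := by
      rw [show h * c = q.out⁻¹ from e, inv_inv]
    rw [← this, mul_inv_rev]
  rw [← QuotientGroup.out_eq' q, e']
  exact (QuotientGroup.mk_mul_of_mem _ (H.inv_mem hh)).symm

/-- For an `H`-stable subspace `W` of `ρ`, the `G`-morphism from the compact induction of `W` to
`ρ` given by Frobenius reciprocity, i.e. `[g, w] ↦ g w`, written as
`f ↦ ∑ g · f(g⁻¹)` over `g ∈ G / H` (the summand depends only on the class of `g`). -/
def frobenius (hH : IsOpen (H : Set G)) (ρ : Representation k G V)
    (W : Subrepresentation (res ρ H)) : cInd W.toRepresentation →ₗ[k] V where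
  toFun f := ∑ᶠ q : G ⧸ H, ρ q.out ((f.1 q.out⁻¹ : W.toSubmodule) : V)
  map_add' f f' := by
    rw [← finsum_add_distrib (frobenius_support_finite hH ρ W f)
      (frobenius_support_finite hH ρ W f')]
    simp
  map_smul' c f := by
    rw [RingHom.id_apply, smul_finsum' c (frobenius_support_finite hH ρ W f)]
    simp

end CompactInduction

section GL2

variable (F : Type*) [Field F] [ValuativeRel F] [TopologicalSpace F] [IsNonarchimedeanLocalField F]

/-- The maximal compact subgroup `K = GL₂(𝒪)` of `G = GL₂(F)`. -/
def K : Subgroup (GL (Fin 2) F) :=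
  (Matrix.GeneralLinearGroup.map (n := Fin 2) (algebraMap 𝒪[F] F)).range

/-- The subgroup `KZ`, with `Z` the centre of `GL₂(F)`. -/
def KZ : Subgroup (GL (Fin 2) F) :=
  K F ⊔ Subgroup.center (GL (Fin 2) F)

theorem isOpen_K : IsOpen (K F : Set (GL (Fin 2) F)) := by
  have hO : IsOpen (𝒪[F] : Set F) := Valuation.isOpen_integer
  have hS : (K F : Set (GL (Fin 2) F)) =
      {g | (∀ i j, g.1 i j ∈ 𝒪[F]) ∧ ∀ i j, g⁻¹.1 i j ∈ 𝒪[F]} := by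
    ext g
    constructor
    · rintro ⟨a, rfl⟩
      exact ⟨fun i j => (a.1 i j).2, fun i j => by
        rw [← map_inv]; exact (a⁻¹.1 i j).2⟩
    · rintro ⟨h1, h2⟩
      have inj : Function.Injective
          (RingHom.mapMatrix (m := Fin 2) (algebraMap 𝒪[F] F)) :=
        Matrix.map_injective Subtype.val_injective
      let A : Matrix (Fin 2) (Fin 2) 𝒪[F] := Matrix.of fun i j => ⟨g.1 i j, h1 i j⟩
      let B : Matrix (Fin 2) (Fin 2) 𝒪[F] := Matrix.of fun i j => ⟨g⁻¹.1 i j, h2 i j⟩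
      have hA : RingHom.mapMatrix (algebraMap 𝒪[F] F) A = g.1 := by ext i j; rfl
      have hB : RingHom.mapMatrix (algebraMap 𝒪[F] F) B = g⁻¹.1 := by ext i j; rfl
      refine ⟨⟨A, B, inj ?_, inj ?_⟩, Units.ext hA⟩
      · rw [map_mul, hA, hB, map_one]; exact g.mul_inv
      · rw [map_mul, hA, hB, map_one]; exact g.inv_mul
  rw [hS]
  have c1 : Continuous fun g : GL (Fin 2) F => g.1 := Units.continuous_val
  have c2 : Continuous fun g : GL (Fin 2) F => g⁻¹.1 := Units.continuous_coe_inv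
  simp only [Set.ofPred_and, Set.ofPred_forall]
  refine IsOpen.inter ?_ ?_
  · exact isOpen_iInter_of_finite fun i => isOpen_iInter_of_finite fun j =>
      hO.preimage (c1.matrix_elem i j)
  · exact isOpen_iInter_of_finite fun i => isOpen_iInter_of_finite fun j =>
      hO.preimage (c2.matrix_elem i j)

theorem isOpen_KZ : IsOpen (KZ F : Set (GL (Fin 2) F)) :=
  Subgroup.isOpen_mono le_sup_left (isOpen_K F)

variable {F}

/-- The matrix `diag(ϖ, 1)` of `GL₂(F)`, for `ϖ` a uniformizer. -/
def diagUnif (ϖ : 𝒪[F]) (hϖ : Irreducible ϖ) : GL (Fin 2) F :=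
  Matrix.GeneralLinearGroup.mkOfDetNeZero !![(ϖ : F), 0; 0, 1] (by
    simpa [Matrix.det_fin_two] using hϖ.ne_zero)

variable {k V : Type*} [Field k] [AddCommGroup V] [Module k V]

/-- The set `𝒲(π)` of finite-dimensional `KZ`-stable subspaces generating `π` over `k[G]`. -/
def genSubspaces (ρ : Representation k (GL (Fin 2) F) V) :
    Set (Subrepresentation (res ρ (KZ F))) :=
  {W | FiniteDimensional k W.toSubmodule ∧ gspan ρ (W.toSubmodule : Set V) = ⊤}

/-- The kernel `R(W, π)` of the morphism from the compact induction of `W` to `π`. -/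
def relations (ρ : Representation k (GL (Fin 2) F) V) (W : Subrepresentation (res ρ (KZ F))) :
    Submodule k (cInd W.toRepresentation) :=
  LinearMap.ker (frobenius (isOpen_KZ F) ρ W)

/-- The set `R⁽⁰⁾(W, π)` of the elements `[α, x] - [1, α x]`, with `α = diag(ϖ, 1)` and
`x ∈ W ∩ α⁻¹ W`, i.e. both `x` and `y = α x` in `W`. -/
def elementaryRelations (ϖ : 𝒪[F]) (hϖ : Irreducible ϖ)
    (ρ : Representation k (GL (Fin 2) F) V) [IsSmooth ρ]
    (W : Subrepresentation (res ρ (KZ F))) : Set (cInd W.toRepresentation) :=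
  {f | ∃ x y : W.toSubmodule, ρ (diagUnif ϖ hϖ) (x : V) = y ∧
    f = bracket (isOpen_KZ F) W.toRepresentation (diagUnif ϖ hϖ) x -
      bracket (isOpen_KZ F) W.toRepresentation 1 y}

/-- The presentation of `π` attached to `W` is finite: `R(W, π)` is finitely generated over
`k[G]`. -/
def IsFinitePresentation (ρ : Representation k (GL (Fin 2) F) V)
    (W : Subrepresentation (res ρ (KZ F))) : Prop :=
  IsFinGen (cIndRep W.toRepresentation) (relations ρ W)

/-- The presentation of `π` attached to `W` is standard: `R(W, π)` is generated over `k[G]` by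
`R⁽⁰⁾(W, π)`. -/
def IsStandardPresentation (ϖ : 𝒪[F]) (hϖ : Irreducible ϖ)
    (ρ : Representation k (GL (Fin 2) F) V) [IsSmooth ρ]
    (W : Subrepresentation (res ρ (KZ F))) : Prop :=
  gspan (cIndRep W.toRepresentation) (elementaryRelations ϖ hϖ ρ W) = relations ρ W

/-- `π` admits a finite presentation. -/
def AdmitsFinitePresentation (ρ : Representation k (GL (Fin 2) F) V) : Prop :=
  ∃ W ∈ genSubspaces ρ, IsFinitePresentation ρ W

/-- `π` admits a standard presentation. -/
def AdmitsStandardPresentation (ϖ : 𝒪[F]) (hϖ : Irreducible ϖ)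
    (ρ : Representation k (GL (Fin 2) F) V) [IsSmooth ρ] : Prop :=
  ∃ W ∈ genSubspaces ρ, IsStandardPresentation ϖ hϖ ρ W

end GL2

end ModPRep

end

/-!
The only facts about `GL₂(F)` behind the theorem are that the open subgroup `KZ` acts locally
finitely and that it generates the group together with `α = diag(ϖ, 1)`.

*Independence of `W`.* Let `W` and `W'` generate `π`. Lift `W` to a finite-dimensional `KZ`-stable
subspace `D` of `c-Ind W'`. The composite `c-Ind D → c-Ind W → π` has finitely generated kernel and
factors through `c-Ind W' → π`, whose kernel is therefore finitely generated.

*Finite implies standard.* Let `W₀ = W`, and let `Wₙ₊₁` be the `KZ`-span of `Wₙ`, `α Wₙ` and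
`α⁻¹ Wₙ`. Inside `c-Ind Wₙ`, write `N` for the `k[G]`-span of the elements `[α, x] - [1, α x]`.
Modulo `N`, every element of `c-Ind W` is congruent in `c-Ind Wₙ` to some `[1, w]` as soon as `n`
is large; if it is a relation, then `w = 0`. A single `n` serves for finitely many generators of the
relations, and since `c-Ind Wₙ` is generated by `N` and the image of `c-Ind W`, all relations in
`c-Ind Wₙ` lie in `N`.
-/

noncomputable section

namespace ModPRep

section GeneratedSubspaces

variable {k G V X Y : Type*} [Field k] [Group G] [AddCommGroup V] [Module k V]
  [AddCommGroup X] [Module k X] [AddCommGroup Y] [Module k Y]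
  {ρ : Representation k G V} {τ : Representation k G X} {σ : Representation k G Y}

theorem subset_gspan (S : Set V) : S ⊆ gspan ρ S := fun s hs =>
  Submodule.subset_span ⟨1, s, hs, by simp⟩

theorem apply_mem_gspan {S : Set V} (g : G) {v : V} (hv : v ∈ gspan ρ S) :
    ρ g v ∈ gspan ρ S := by
  suffices gspan ρ S ≤ (gspan ρ S).comap (ρ g) from this hv
  refine Submodule.span_le.2 ?_
  rintro _ ⟨a, s, hs, rfl⟩
  exact Submodule.subset_span ⟨g * a, s, hs, by simp⟩

variable (ρ) in
/-- The space `gspan ρ S` as a subrepresentation: the smallest one containing `S`. -/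
def generatedSubrep (S : Set V) : Subrepresentation ρ where
  toSubmodule := gspan ρ S
  apply_mem_toSubmodule g _ hv := apply_mem_gspan g hv

theorem gspan_le {S : Set V} {N : Submodule k V} (hN : ∀ g : G, ∀ v ∈ N, ρ g v ∈ N)
    (h : S ⊆ N) : gspan ρ S ≤ N := by
  refine Submodule.span_le.2 ?_
  rintro _ ⟨g, s, hs, rfl⟩
  exact hN g s (h hs)

theorem gspan_le_gspan {S T : Set V} (h : S ⊆ gspan ρ T) : gspan ρ S ≤ gspan ρ T :=
  gspan_le (fun g _ hv => apply_mem_gspan g hv) h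

theorem gspan_mono {S T : Set V} (h : S ⊆ T) : gspan ρ S ≤ gspan ρ T :=
  gspan_le_gspan (h.trans (subset_gspan T))

theorem gspan_span (S : Set V) : gspan ρ (Submodule.span k S : Set V) = gspan ρ S :=
  le_antisymm (gspan_le_gspan (Submodule.span_le.2 (subset_gspan S)))
    (gspan_mono Submodule.subset_span)

theorem gspan_subrep (W : Subrepresentation ρ) :
    gspan ρ (W.toSubmodule : Set V) = W.toSubmodule :=
  le_antisymm (gspan_le W.apply_mem_toSubmodule subset_rfl) (subset_gspan _)

theorem gspan_empty : gspan ρ (∅ : Set V) = ⊥ := by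
  simp [gspan]

theorem gspan_union (S T : Set V) : gspan ρ (S ∪ T) = gspan ρ S ⊔ gspan ρ T := by
  rw [gspan, gspan, gspan, ← Submodule.span_union]
  congr 1
  ext v
  simp only [Set.mem_ofPred_eq, Set.mem_union, or_and_right, exists_or]

theorem map_gspan (f : τ.IntertwiningMap ρ) (S : Set X) :
    (gspan τ S).map f.toLinearMap = gspan ρ (f '' S) := by
  rw [gspan, gspan, Submodule.map_span]
  congr 1
  ext v
  simp [f.isIntertwining, @eq_comm _ v]

theorem isFinGen_gspan_of_subset {S : Set V} {D : Submodule k V} [FiniteDimensional k D]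
    (h : S ⊆ D) : IsFinGen ρ (gspan ρ S) := by
  have : FiniteDimensional k (Submodule.span k S) :=
    Submodule.finiteDimensional_of_le (Submodule.span_le.2 h)
  obtain ⟨T, hT, hTS⟩ := Submodule.fg_def.1 ((Submodule.fg_iff_finiteDimensional _).2 this)
  exact ⟨T, hT, by rw [← gspan_span T, hTS, gspan_span]⟩

theorem IsFinGen.ker_comp {f : τ.IntertwiningMap σ} {q : σ.IntertwiningMap ρ}
    (hf : Function.Surjective f) (hkf : IsFinGen τ (LinearMap.ker f.toLinearMap))
    (hkq : IsFinGen σ (LinearMap.ker q.toLinearMap)) :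
    IsFinGen τ (LinearMap.ker (q.comp f).toLinearMap) := by
  obtain ⟨S, hS, hSf⟩ := hkf
  obtain ⟨T, hT, hTq⟩ := hkq
  have image_preimage : f '' (Function.surjInv hf '' T) = T := by
    simp [Set.image_image, Function.surjInv_eq hf]
  refine ⟨Function.surjInv hf '' T ∪ S, (hT.image _).union hS, ?_⟩
  calc gspan τ (Function.surjInv hf '' T ∪ S)
      = gspan τ (Function.surjInv hf '' T) ⊔ LinearMap.ker f.toLinearMap := by
        rw [gspan_union, hSf]
    _ = ((gspan τ (Function.surjInv hf '' T)).map f.toLinearMap).comap f.toLinearMap :=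
        (Submodule.comap_map_eq _ _).symm
    _ = LinearMap.ker (q.comp f).toLinearMap := by
        rw [map_gspan, image_preimage, hTq, ← LinearMap.ker_comp,
          Representation.IntertwiningMap.comp_toLinearMap]

/-- The kernel of `p` is generated by `Φ (ker q)` and the differences `t - Φ y`, where `t` runs
through generators of `X` and `q y = p t`. -/
theorem IsFinGen.ker_of_lift {p : τ.IntertwiningMap ρ} {q : σ.IntertwiningMap ρ}
    {Φ : σ.IntertwiningMap τ} (hΦ : p.comp Φ = q) (hq : Function.Surjective q)
    (hX : IsFinGen τ ⊤) (hkq : IsFinGen σ (LinearMap.ker q.toLinearMap)) :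
    IsFinGen τ (LinearMap.ker p.toLinearMap) := by
  obtain ⟨T, hT, hTX⟩ := hX
  obtain ⟨S, hS, hSq⟩ := hkq
  have p_Φ (y : Y) : p (Φ y) = q y := by rw [← hΦ, Representation.IntertwiningMap.comp_apply]
  set d : X → X := fun t => t - Φ (Function.surjInv hq (p t))
  refine ⟨d '' T ∪ Φ '' S, (hT.image _).union (hS.image _), ?_⟩
  have le_ker : gspan τ (d '' T ∪ Φ '' S) ≤ LinearMap.ker p.toLinearMap := by
    refine gspan_le p.ker.apply_mem_toSubmodule (Set.union_subset ?_ ?_)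
    · rintro _ ⟨t, -, rfl⟩
      simp [d, p_Φ, Function.surjInv_eq]
    · rintro _ ⟨s, hs, rfl⟩
      have : s ∈ LinearMap.ker q.toLinearMap := hSq ▸ subset_gspan S hs
      simpa [p_Φ] using this
  have map_ker_le : (LinearMap.ker q.toLinearMap).map Φ.toLinearMap ≤
      gspan τ (d '' T ∪ Φ '' S) := by
    rw [← hSq, map_gspan]
    exact gspan_mono Set.subset_union_right
  have sup_range : gspan τ (d '' T ∪ Φ '' S) ⊔ LinearMap.range Φ.toLinearMap = ⊤ := by
    rw [eq_top_iff, ← hTX]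
    refine gspan_le (generatedSubrep τ (d '' T ∪ Φ '' S) ⊔ Φ.range).apply_mem_toSubmodule ?_
    intro t ht
    exact Submodule.mem_sup.2 ⟨d t, subset_gspan _ (.inl ⟨t, ht, rfl⟩),
      Φ (Function.surjInv hq (p t)), ⟨_, rfl⟩, sub_add_cancel _ _⟩
  refine le_antisymm le_ker fun x hx => ?_
  obtain ⟨n, hn, _, ⟨y, rfl⟩, rfl⟩ := Submodule.mem_sup.1 (sup_range ▸ Submodule.mem_top (x := x))
  refine add_mem hn (map_ker_le ⟨y, ?_, rfl⟩)
  have : p n + p (Φ y) = 0 := by simpa using hx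
  have hpn : p n = 0 := le_ker hn
  simpa [hpn, p_Φ] using this

end GeneratedSubspaces

section LocallyFinite

variable {k G V : Type*} [Field k] [Group G] [AddCommGroup V] [Module k V]
  {ρ : Representation k G V}

/-- A representation is locally finite if every vector generates a finite-dimensional
subrepresentation. -/
def IsLocallyFinite (ρ : Representation k G V) : Prop :=
  ∀ v : V, FiniteDimensional k (gspan ρ {v})

theorem IsLocallyFinite.finiteDimensional_gspan (h : IsLocallyFinite ρ) {S : Set V}
    (hS : S.Finite) : FiniteDimensional k (gspan ρ S) := by
  induction S, hS using Set.Finite.induction_on with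
  | empty =>
    rw [gspan_empty]
    infer_instance
  | @insert v S _ _ ih =>
    have := h v
    rw [Set.insert_eq, gspan_union]
    infer_instance

theorem IsLocallyFinite.finiteDimensional_gspan_submodule (h : IsLocallyFinite ρ)
    (E : Submodule k V) [FiniteDimensional k E] : FiniteDimensional k (gspan ρ (E : Set V)) := by
  obtain ⟨T, hT, rfl⟩ := Submodule.fg_def.1 ((Submodule.fg_iff_finiteDimensional E).2 ‹_›)
  rw [gspan_span]
  exact h.finiteDimensional_gspan hT

theorem IsLocallyFinite.res_sup_center {H : Subgroup G} (h : IsLocallyFinite (res ρ H))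
    (hZ : HasCentralCharacter ρ) : IsLocallyFinite (res ρ (H ⊔ Subgroup.center G)) := by
  obtain ⟨χ, hχ⟩ := hZ
  intro v
  have := h v
  refine Submodule.finiteDimensional_of_le (S₂ := gspan (res ρ H) {v}) (Submodule.span_le.2 ?_)
  rintro _ ⟨⟨a, ha⟩, _, rfl, rfl⟩
  obtain ⟨b, hb, z, hz, rfl⟩ := Subgroup.mem_sup_of_normal_right.1 ha
  change ρ (b * z) _ ∈ _
  rw [map_mul, Module.End.mul_apply, hχ ⟨z, hz⟩, map_smul]
  exact Submodule.smul_mem _ _ (apply_mem_gspan (ρ := res ρ H) ⟨b, hb⟩ (subset_gspan _ rfl))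

variable [TopologicalSpace G] [IsTopologicalGroup G]

theorem isLocallyConstant_apply (ρ : Representation k G V) [IsSmooth ρ] (v : V) :
    IsLocallyConstant fun g => ρ g v := by
  rw [IsLocallyConstant.iff_exists_open]
  intro g
  obtain ⟨U, hU, hUv⟩ := IsSmooth.exists_open (ρ := ρ) v
  refine ⟨(fun x => g⁻¹ * x) ⁻¹' U, hU.preimage (continuous_const_mul g⁻¹), by simp, fun x hx => ?_⟩
  rw [← mul_inv_cancel_left g x, map_mul, Module.End.mul_apply, hUv _ hx]

theorem isLocallyFinite_of_compactSpace [CompactSpace G] (ρ : Representation k G V)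
    [IsSmooth ρ] : IsLocallyFinite ρ := fun v =>
  FiniteDimensional.span_of_finite k <|
    (isLocallyConstant_apply ρ v).range_finite.subset (by simp [Set.subset_def])

end LocallyFinite

section CompactInduction

open Representation (IntertwiningMap)

variable {k G M N V : Type*} [Field k] [Group G] [TopologicalSpace G] [IsTopologicalGroup G]
  [AddCommGroup M] [Module k M] [AddCommGroup N] [Module k N] [AddCommGroup V] [Module k V]
  {H : Subgroup G} {σ : Representation k H M} {τ : Representation k H N}

theorem cIndRep_apply (g : G) (f : cInd σ) (x : G) : (cIndRep σ g f).1 x = f.1 (x * g) := rfl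

theorem cIndRep_apply_of_mem_center {z : G} (hz : z ∈ Subgroup.center G) (hzH : z ∈ H) {c : k}
    (hc : ∀ v, σ ⟨z, hzH⟩ v = c • v) (f : cInd σ) : cIndRep σ z f = c • f := by
  ext x
  rw [cIndRep_apply, Subgroup.mem_center_iff.1 hz x]
  exact (f.2.2.2 ⟨z, hzH⟩ x).trans (hc _)

theorem support_out_finite (hH : IsOpen (H : Set G)) (f : cInd σ) :
    (Function.support fun q : G ⧸ H => f.1 q.out⁻¹).Finite := by
  obtain ⟨f, -, ⟨C, hC, hs⟩, -⟩ := f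
  have : DiscreteTopology (G ⧸ H) := QuotientGroup.discreteTopology hH
  have finite_image : ((fun g : G => (g : G ⧸ H)) '' C⁻¹).Finite :=
    (hC.inv.image QuotientGroup.continuous_mk).finite_of_discrete
  refine finite_image.subset fun q hq => ?_
  obtain ⟨h, hh, c, hc, hhc⟩ := hs (show q.out⁻¹ ∈ Function.support f from hq)
  have out_eq : q.out = c⁻¹ * h⁻¹ := by
    rw [← mul_inv_rev, show h * c = q.out⁻¹ from hhc, inv_inv]
  refine ⟨c⁻¹, Set.inv_mem_inv.mpr hc, ?_⟩
  rw [← QuotientGroup.out_eq' q, out_eq]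
  exact (QuotientGroup.mk_mul_of_mem _ (H.inv_mem hh)).symm

section Bracket

theorem bracket_apply_of_mem (hH : IsOpen (H : Set G)) (σ : Representation k H M) [IsSmooth σ]
    {g x : G} (hx : x * g ∈ H) (v : M) : (bracket hH σ g v).1 x = σ ⟨x * g, hx⟩ v :=
  dif_pos hx

theorem bracket_apply_of_notMem (hH : IsOpen (H : Set G)) (σ : Representation k H M) [IsSmooth σ]
    {g x : G} (hx : x * g ∉ H) (v : M) : (bracket hH σ g v).1 x = 0 :=
  dif_neg hx

/-- The bracket `[g, v]` as a linear map in `v`. -/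
def bracketLinear (hH : IsOpen (H : Set G)) (σ : Representation k H M) [IsSmooth σ] (g : G) :
    M →ₗ[k] cInd σ where
  toFun := bracket hH σ g
  map_add' v w := by
    ext x
    by_cases hx : x * g ∈ H
    · simp [bracket_apply_of_mem hH σ hx]
    · simp [bracket_apply_of_notMem hH σ hx]
  map_smul' c v := by
    ext x
    by_cases hx : x * g ∈ H
    · simp [bracket_apply_of_mem hH σ hx]
    · simp [bracket_apply_of_notMem hH σ hx]

theorem bracketLinear_apply (hH : IsOpen (H : Set G)) (σ : Representation k H M) [IsSmooth σ]
    (g : G) (v : M) : bracketLinear hH σ g v = bracket hH σ g v := rfl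

variable (hH : IsOpen (H : Set G)) (σ) [IsSmooth σ]

theorem cIndRep_bracket (a g : G) (v : M) :
    cIndRep σ a (bracket hH σ g v) = bracket hH σ (a * g) v := by
  ext x
  rw [cIndRep_apply]
  by_cases hx : x * a * g ∈ H
  · have hx' : x * (a * g) ∈ H := by rwa [← mul_assoc]
    rw [bracket_apply_of_mem hH σ hx, bracket_apply_of_mem hH σ hx']
    exact congrArg (fun b : H => σ b v) (Subtype.ext (mul_assoc x a g))
  · have hx' : x * (a * g) ∉ H := by rwa [← mul_assoc]
    rw [bracket_apply_of_notMem hH σ hx, bracket_apply_of_notMem hH σ hx']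

theorem bracket_eq_cIndRep (g : G) (v : M) :
    bracket hH σ g v = cIndRep σ g (bracket hH σ 1 v) := by
  rw [cIndRep_bracket, mul_one]

theorem bracket_mul_of_mem (g : G) (h : H) (v : M) :
    bracket hH σ (g * h) v = bracket hH σ g (σ h v) := by
  ext x
  by_cases hx : x * g ∈ H
  · have hx' : x * (g * h) ∈ H := by rw [← mul_assoc]; exact H.mul_mem hx h.2
    rw [bracket_apply_of_mem hH σ hx, bracket_apply_of_mem hH σ hx', ← Module.End.mul_apply,
      ← map_mul]
    exact congrArg (fun b : H => σ b v) (Subtype.ext (mul_assoc x g h).symm)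
  · have hx' : x * (g * h) ∉ H := by rwa [← mul_assoc, H.mul_mem_cancel_right h.2]
    rw [bracket_apply_of_notMem hH σ hx, bracket_apply_of_notMem hH σ hx']

theorem cIndRep_bracket_one_of_mem (h : H) (v : M) :
    cIndRep σ h (bracket hH σ 1 v) = bracket hH σ 1 (σ h v) := by
  rw [cIndRep_bracket, mul_one, ← bracket_mul_of_mem, one_mul]

variable {σ}

theorem eq_sum_bracket (f : cInd σ) :
    f = ∑ q ∈ (support_out_finite hH f).toFinset, bracket hH σ q.out (f.1 q.out⁻¹) := by
  classical
  ext x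
  have hx : x * ((x⁻¹ : G) : G ⧸ H).out ∈ H := by
    simpa using QuotientGroup.eq.1 (QuotientGroup.out_eq' ((x⁻¹ : G) : G ⧸ H)).symm
  rw [AddSubmonoidClass.coe_finsetSum, Finset.sum_apply,
    Finset.sum_eq_single ((x⁻¹ : G) : G ⧸ H)]
  · rw [bracket_apply_of_mem hH σ hx, ← f.2.2.2]
    simp
  · intro q _ hq
    refine bracket_apply_of_notMem hH σ (fun hm => hq ?_) _
    rw [← QuotientGroup.out_eq' q, eq_comm]
    exact QuotientGroup.eq.2 (by rwa [inv_inv])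
  · intro hq
    rw [Set.Finite.mem_toFinset, Function.notMem_support] at hq
    rw [bracket_apply_of_mem hH σ hx, hq, map_zero]

theorem mem_of_bracket_mem {P : Submodule k (cInd σ)} (hP : ∀ g : G, ∀ f ∈ P, cIndRep σ g f ∈ P)
    {f : cInd σ} (hf : ∀ g, bracket hH σ 1 (f.1 g) ∈ P) : f ∈ P := by
  rw [eq_sum_bracket hH f]
  refine sum_mem fun q _ => ?_
  rw [bracket_eq_cIndRep]
  exact hP _ _ (hf _)

theorem gspan_range_bracket_one : gspan (cIndRep σ) (Set.range (bracket hH σ 1)) = ⊤ :=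
  eq_top_iff.2 fun _ _ => mem_of_bracket_mem hH (fun g _ => apply_mem_gspan g)
    fun _ => subset_gspan _ ⟨_, rfl⟩

theorem cInd_hom_ext {ρ : Representation k G V} {f f' : (cIndRep σ).IntertwiningMap ρ}
    (h : ∀ v, f (bracket hH σ 1 v) = f' (bracket hH σ 1 v)) : f = f' := by
  refine IntertwiningMap.ext (LinearMap.ext fun x => ?_)
  have range_le : Set.range (bracket hH σ 1) ⊆ LinearMap.eqLocus f.toLinearMap f'.toLinearMap := by
    rintro _ ⟨v, rfl⟩
    exact h v
  refine gspan_le (ρ := cIndRep σ) (fun g y (hy : f y = f' y) => ?_) range_le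
    (gspan_range_bracket_one hH (σ := σ) ▸ Submodule.mem_top)
  change f _ = f' _
  rw [f.isIntertwining, f'.isIntertwining, hy]

include hH in
theorem isFinGen_cIndRep [FiniteDimensional k M] : IsFinGen (cIndRep σ) ⊤ := by
  rw [← gspan_range_bracket_one hH]
  exact isFinGen_gspan_of_subset (D := LinearMap.range (bracketLinear hH σ 1)) subset_rfl

theorem exists_open_fixing_bracket (g : G) (v : M) :
    ∃ U : Subgroup G, IsOpen (U : Set G) ∧
      ∀ x ∈ U, cIndRep σ x (bracket hH σ g v) = bracket hH σ g v := by
  obtain ⟨U, hU, hUv⟩ := IsSmooth.exists_open (ρ := σ) v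
  refine ⟨(U.map H.subtype).comap (MulAut.conj g⁻¹).toMonoidHom, ?_, ?_⟩
  · refine (hH.isOpenMap_subtype_val _ hU).preimage (f := fun x => g⁻¹ * x * g⁻¹⁻¹) ?_
    fun_prop
  · rintro x ⟨u, hu, hux : (u : G) = g⁻¹ * x * g⁻¹⁻¹⟩
    have x_mul : x * g = g * u := by rw [hux]; group
    rw [cIndRep_bracket, x_mul, bracket_mul_of_mem, hUv u hu]

include hH in
theorem isSmooth_cIndRep : IsSmooth (cIndRep σ) where
  exists_open f := by
    rw [eq_sum_bracket hH f]
    refine Finset.sum_induction _ (fun f => ∃ U : Subgroup G, IsOpen (U : Set G) ∧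
      ∀ g ∈ U, cIndRep σ g f = f) ?_ ⟨⊤, isOpen_univ, by simp⟩
      fun q _ => exists_open_fixing_bracket hH _ _
    rintro a b ⟨U, hU, hUa⟩ ⟨U', hU', hUb⟩
    exact ⟨U ⊓ U', hU.inter hU', fun g hg => by rw [map_add, hUa g hg.1, hUb g hg.2]⟩

end Bracket

section Functoriality

variable (u : σ.IntertwiningMap τ)

/-- Functoriality of compact induction: composition `f ↦ u ∘ f` with an `H`-morphism `u`. -/
def cIndMap : (cIndRep σ).IntertwiningMap (cIndRep τ) where
  toFun f := ⟨fun g => u (f.1 g), f.2.1.comp u,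
    f.2.2.1.imp fun _ hC => ⟨hC.1, (Function.support_comp_subset (map_zero u) f.1).trans hC.2⟩,
    fun h g => (congrArg u (f.2.2.2 h g)).trans (u.isIntertwining _ _ h _)⟩
  map_add' f f' := by ext g; exact map_add u (f.1 g) (f'.1 g)
  map_smul' c f := by ext g; exact map_smul u c (f.1 g)
  isIntertwining' _ := rfl

theorem cIndMap_apply (f : cInd σ) (g : G) : (cIndMap u f).1 g = u (f.1 g) := rfl

variable (hH : IsOpen (H : Set G)) [IsSmooth σ]

theorem cIndMap_bracket [IsSmooth τ] (g : G) (v : M) :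
    cIndMap u (bracket hH σ g v) = bracket hH τ g (u v) := by
  ext x
  rw [cIndMap_apply]
  by_cases hx : x * g ∈ H
  · rw [bracket_apply_of_mem hH σ hx, bracket_apply_of_mem hH τ hx, u.isIntertwining]
  · rw [bracket_apply_of_notMem hH σ hx, bracket_apply_of_notMem hH τ hx, map_zero]

theorem ker_cIndMap [IsSmooth τ] : LinearMap.ker (cIndMap u).toLinearMap =
    gspan (cIndRep σ) (bracket hH σ 1 '' {v | u v = 0}) := by
  refine le_antisymm (fun f hf => ?_) (gspan_le (cIndMap u).ker.apply_mem_toSubmodule ?_)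
  · refine mem_of_bracket_mem hH (fun g _ => apply_mem_gspan g) fun g => subset_gspan _ ⟨_, ?_, rfl⟩
    exact congrArg (fun f : cInd τ => f.1 g) hf
  · rintro _ ⟨v, hv : u v = 0, rfl⟩
    exact (cIndMap_bracket u hH 1 v).trans (by rw [hv]; exact map_zero (bracketLinear hH τ 1))

include hH in
theorem isFinGen_ker_cIndMap [IsSmooth τ] [FiniteDimensional k M] :
    IsFinGen (cIndRep σ) (LinearMap.ker (cIndMap u).toLinearMap) := by
  rw [ker_cIndMap u hH]
  refine isFinGen_gspan_of_subset (D := LinearMap.range (bracketLinear hH σ 1)) ?_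
  rintro _ ⟨v, -, rfl⟩
  exact ⟨v, rfl⟩

include hH in
theorem cIndMap_surjective [IsSmooth τ] (hu : Function.Surjective u) :
    Function.Surjective (cIndMap u) := by
  intro f
  refine mem_of_bracket_mem (P := LinearMap.range (cIndMap u).toLinearMap) hH
    (cIndMap u).range.apply_mem_toSubmodule fun g => ?_
  obtain ⟨v, hv⟩ := hu (f.1 g)
  exact ⟨bracket hH σ 1 v, by rw [← hv]; exact cIndMap_bracket u hH 1 v⟩

end Functoriality

section Frobenius

variable (hH : IsOpen (H : Set G)) (ρ : Representation k G V) [IsSmooth ρ]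
  (W : Subrepresentation (res ρ H))

theorem frobenius_bracket (g : G) (w : W.toSubmodule) :
    frobenius hH ρ W (bracket hH W.toRepresentation g w) = ρ g w := by
  have hg : (g : G ⧸ H).out⁻¹ * g ∈ H := QuotientGroup.eq.1 (QuotientGroup.out_eq' (g : G ⧸ H))
  refine (finsum_eq_single _ (g : G ⧸ H) fun q hq => ?_).trans ?_
  · have : q.out⁻¹ * g ∉ H := fun h => hq (by
      rw [← QuotientGroup.out_eq' q]; exact QuotientGroup.eq.2 h)
    rw [bracket_apply_of_notMem hH _ this, Submodule.coe_zero, map_zero]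
  · rw [bracket_apply_of_mem hH _ hg]
    change ρ _ (ρ ((g : G ⧸ H).out⁻¹ * g) (w : V)) = _
    rw [← Module.End.mul_apply, ← map_mul, mul_inv_cancel_left]

theorem frobenius_cIndRep (g : G) (f : cInd W.toRepresentation) :
    frobenius hH ρ W (cIndRep W.toRepresentation g f) = ρ g (frobenius hH ρ W f) := by
  rw [eq_sum_bracket hH f]
  simp only [map_sum, cIndRep_bracket, frobenius_bracket, map_mul, Module.End.mul_apply]

/-- The Frobenius map `[g, w] ↦ g w` as a `G`-morphism. -/
def frobeniusHom : (cIndRep W.toRepresentation).IntertwiningMap ρ :=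
  (frobenius hH ρ W).intertwiningMap_of_isIntertwiningMap _ _ (frobenius_cIndRep hH ρ W)

theorem frobeniusHom_bracket (g : G) (w : W.toSubmodule) :
    frobeniusHom hH ρ W (bracket hH W.toRepresentation g w) = ρ g w :=
  frobenius_bracket hH ρ W g w

theorem frobeniusHom_surjective (hW : gspan ρ (W.toSubmodule : Set V) = ⊤) :
    Function.Surjective (frobeniusHom hH ρ W) := by
  suffices gspan ρ (W.toSubmodule : Set V) ≤ (frobeniusHom hH ρ W).range.toSubmodule from
    fun v => this (hW ▸ Submodule.mem_top)
  refine gspan_le (frobeniusHom hH ρ W).range.apply_mem_toSubmodule fun w hw => ?_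
  exact ⟨bracket hH W.toRepresentation 1 ⟨w, hw⟩, by simp [frobeniusHom_bracket]⟩

end Frobenius

end CompactInduction

section Independence

open Representation (IntertwiningMap)

theorem IsLocallyFinite.exists_subrep_map_eq {k G V X : Type*} [Field k] [Group G]
    [AddCommGroup V] [Module k V] [AddCommGroup X] [Module k X] {ρ : Representation k G V}
    {τ : Representation k G X} (hτ : IsLocallyFinite τ) {f : τ.IntertwiningMap ρ}
    (hf : Function.Surjective f) (W : Subrepresentation ρ) [FiniteDimensional k W.toSubmodule] :
    ∃ D : Subrepresentation τ, FiniteDimensional k D.toSubmodule ∧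
      D.toSubmodule.map f.toLinearMap = W.toSubmodule := by
  obtain ⟨T, hT, hTW⟩ :=
    Submodule.fg_def.1 ((Submodule.fg_iff_finiteDimensional W.toSubmodule).2 ‹_›)
  refine ⟨generatedSubrep τ (Function.surjInv hf '' T),
    hτ.finiteDimensional_gspan (hT.image _), ?_⟩
  calc (gspan τ (Function.surjInv hf '' T)).map f.toLinearMap
      = gspan ρ T := by rw [map_gspan, Set.image_image]; simp [Function.surjInv_eq hf]
    _ = W.toSubmodule := by rw [← gspan_span, hTW, gspan_subrep]

variable {k G V X : Type*} [Field k] [Group G] [AddCommGroup V] [Module k V]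
  [AddCommGroup X] [Module k X] {ρ : Representation k G V} {τ : Representation k G X}
  {H : Subgroup G}

/-- The `H`-morphism `D → W` between `H`-stable subspaces induced by a `G`-morphism `p` that maps
`D` into `W`. -/
def restrictHom (p : τ.IntertwiningMap ρ) {D : Subrepresentation (res τ H)}
    {W : Subrepresentation (res ρ H)} (h : ∀ x ∈ D.toSubmodule, p x ∈ W.toSubmodule) :
    D.toRepresentation.IntertwiningMap W.toRepresentation where
  toLinearMap := p.toLinearMap.restrict h
  isIntertwining' g := LinearMap.ext fun x => Subtype.ext (p.isIntertwining _ _ (g : G) x)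

variable [TopologicalSpace G] [IsTopologicalGroup G] [IsSmooth ρ] [IsSmooth τ]
  (hH : IsOpen (H : Set G))

theorem frobeniusHom_comp_cIndMap (p : τ.IntertwiningMap ρ) {D : Subrepresentation (res τ H)}
    {W : Subrepresentation (res ρ H)} (h : ∀ x ∈ D.toSubmodule, p x ∈ W.toSubmodule) :
    (frobeniusHom hH ρ W).comp (cIndMap (restrictHom p h)) = p.comp (frobeniusHom hH τ D) :=
  cInd_hom_ext hH fun x => by
    rw [IntertwiningMap.comp_apply, IntertwiningMap.comp_apply, cIndMap_bracket,
      frobeniusHom_bracket, frobeniusHom_bracket, p.isIntertwining]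
    rfl

/-- Lift `W` to a finite-dimensional `H`-stable subspace `D` of `X`. The presentation of `V` by the
compact induction of `W` remains finite when pulled back to that of `D`, and the pull-back factors
through `X`. -/
theorem isFinGen_ker_of_isFinGen_ker_frobenius {p : τ.IntertwiningMap ρ}
    (hp : Function.Surjective p) (hX : IsFinGen τ ⊤) (hτ : IsLocallyFinite (res τ H))
    (W : Subrepresentation (res ρ H)) [FiniteDimensional k W.toSubmodule]
    (hWV : gspan ρ (W.toSubmodule : Set V) = ⊤)
    (hW : IsFinGen (cIndRep W.toRepresentation) (LinearMap.ker (frobenius hH ρ W))) :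
    IsFinGen τ (LinearMap.ker p.toLinearMap) := by
  let pH : (res τ H).IntertwiningMap (res ρ H) := ⟨p.toLinearMap, fun h => p.isIntertwining' h⟩
  obtain ⟨D, _, hDW⟩ := hτ.exists_subrep_map_eq (f := pH) hp W
  have maps_to (x : X) (hx : x ∈ D.toSubmodule) : p x ∈ W.toSubmodule := hDW ▸ ⟨x, hx, rfl⟩
  have cIndMap_surjective : Function.Surjective (cIndMap (restrictHom p maps_to)) := by
    refine cIndMap_surjective _ hH fun w => ?_
    obtain ⟨x, hx, hxw⟩ := hDW.ge w.2
    exact ⟨⟨x, hx⟩, Subtype.ext hxw⟩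
  exact IsFinGen.ker_of_lift (frobeniusHom_comp_cIndMap hH p maps_to).symm
    ((frobeniusHom_surjective hH ρ W hWV).comp cIndMap_surjective) hX
    (IsFinGen.ker_comp cIndMap_surjective (isFinGen_ker_cIndMap _ hH) hW)

end Independence

section EdgeRelations

open Representation (IntertwiningMap)

variable {k G V : Type*} [Field k] [Group G] [AddCommGroup V] [Module k V]
  {ρ : Representation k G V} {H : Subgroup G} {α : G}

theorem apply_mem_of_sup_zpowers_eq_top (hα : H ⊔ Subgroup.zpowers α = ⊤) {P : Submodule k V}
    (hPH : ∀ h ∈ H, ∀ v ∈ P, ρ h v ∈ P) (hPα : ∀ a ∈ ({α, α⁻¹} : Set G), ∀ v ∈ P, ρ a v ∈ P)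
    (g : G) {v : V} (hv : v ∈ P) : ρ g v ∈ P := by
  let S : Subgroup G :=
    { carrier := {g | ∀ v, ρ g v ∈ P ↔ v ∈ P}
      one_mem' := by simp
      mul_mem' := fun {a b} ha hb v => by rw [map_mul, Module.End.mul_apply, ha, hb]
      inv_mem' := fun {a} ha v => by rw [← ha, ρ.self_inv_apply] }
  have mem_S (a : G) (ha : ∀ v ∈ P, ρ a v ∈ P) (ha' : ∀ v ∈ P, ρ a⁻¹ v ∈ P) : a ∈ S := fun v =>
    ⟨fun h => by simpa using ha' _ h, ha v⟩
  have S_eq_top : S = ⊤ := by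
    refine top_le_iff.1 (hα ▸ sup_le (fun h hh => ?_) (Subgroup.zpowers_le.2 ?_))
    · exact mem_S h (hPH h hh) (hPH h⁻¹ (H.inv_mem hh))
    · exact mem_S α (hPα α (.inl rfl)) (hPα α⁻¹ (.inr rfl))
  exact ((S_eq_top ▸ Subgroup.mem_top g : g ∈ S) v).2 hv

variable [TopologicalSpace G] [IsTopologicalGroup G] [IsSmooth ρ] (hH : IsOpen (H : Set G))
  (W : Subrepresentation (res ρ H))

variable (ρ α) in
/-- The elements `[α, x] - [1, α x]` with `x` and `α x` in `W`, for an arbitrary open subgroup and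
an arbitrary `α`; these are the elements of `elementaryRelations` when `H = KZ` and
`α = diag(ϖ, 1)`. -/
def edgeRelations : Set (cInd W.toRepresentation) :=
  {f | ∃ x y : W.toSubmodule, ρ α (x : V) = y ∧
    f = bracket hH W.toRepresentation α x - bracket hH W.toRepresentation 1 y}

variable (ρ α) in
/-- The subrepresentation generated by `edgeRelations`. -/
def edgeSubrep : Subrepresentation (cIndRep W.toRepresentation) :=
  generatedSubrep _ (edgeRelations ρ α hH W)

theorem isFinGen_edgeSubrep [FiniteDimensional k W.toSubmodule] :
    IsFinGen (cIndRep W.toRepresentation) (edgeSubrep ρ α hH W).toSubmodule := by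
  refine isFinGen_gspan_of_subset (D := LinearMap.range (bracketLinear hH W.toRepresentation α) ⊔
    LinearMap.range (bracketLinear hH W.toRepresentation 1)) ?_
  rintro _ ⟨x, y, -, rfl⟩
  exact sub_mem (Submodule.mem_sup_left ⟨x, rfl⟩) (Submodule.mem_sup_right ⟨y, rfl⟩)

theorem edgeSubrep_le_ker_frobenius : edgeSubrep ρ α hH W ≤ (frobeniusHom hH ρ W).ker := by
  refine gspan_le (frobeniusHom hH ρ W).ker.apply_mem_toSubmodule ?_
  rintro _ ⟨x, y, hxy, rfl⟩
  change frobeniusHom hH ρ W _ = 0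
  rw [map_sub, frobeniusHom_bracket, frobeniusHom_bracket, hxy, map_one, Module.End.one_apply,
    sub_self]

theorem bracket_sub_bracket_mem_edgeSubrep {a : G} (ha : a ∈ ({α, α⁻¹} : Set G))
    {x y : W.toSubmodule} (hxy : ρ a (x : V) = y) :
    bracket hH W.toRepresentation a x - bracket hH W.toRepresentation 1 y ∈
      (edgeSubrep ρ α hH W).toSubmodule := by
  obtain rfl | rfl := ha
  · exact subset_gspan _ ⟨x, y, hxy, rfl⟩
  · have hyx : ρ α (y : V) = x := by rw [← hxy, ρ.self_inv_apply]
    have := (edgeSubrep ρ α hH W).apply_mem_toSubmodule α⁻¹ (subset_gspan _ ⟨y, x, hyx, rfl⟩)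
    rw [map_sub, cIndRep_bracket, cIndRep_bracket, inv_mul_cancel, mul_one] at this
    exact neg_sub (bracket hH W.toRepresentation 1 y) _ ▸ Submodule.neg_mem _ this

variable (ρ α) in
/-- The space `[1, W] + N` with `N` the `k[G]`-span of the edge relations. Modulo `N`, it consists
of the elements of the compact induction that are supported at the base vertex. -/
def baseSubrep : Subrepresentation (res (cIndRep W.toRepresentation) H) where
  toSubmodule := LinearMap.range (bracketLinear hH W.toRepresentation 1) ⊔
    (edgeSubrep ρ α hH W).toSubmodule
  apply_mem_toSubmodule h := by
    simp only [Submodule.forall_mem_sup]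
    rintro _ ⟨w, rfl⟩ n hn
    refine map_add (cIndRep W.toRepresentation h) _ n ▸ Submodule.add_mem_sup ?_
      ((edgeSubrep ρ α hH W).apply_mem_toSubmodule (h : G) hn)
    exact ⟨W.toRepresentation h w, (cIndRep_bracket_one_of_mem _ hH h w).symm⟩

variable {hH W}

theorem exists_bracket_add_of_mem_baseSubrep {x : cInd W.toRepresentation}
    (hx : x ∈ (baseSubrep ρ α hH W).toSubmodule) :
    ∃ w, ((w : W.toSubmodule) : V) = frobenius hH ρ W x ∧
      ∃ n ∈ (edgeSubrep ρ α hH W).toSubmodule, x = bracket hH W.toRepresentation 1 w + n := by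
  obtain ⟨_, ⟨w, rfl⟩, n, hn, rfl⟩ := Submodule.mem_sup.1 hx
  have hn0 : frobenius hH ρ W n = 0 := edgeSubrep_le_ker_frobenius hH W hn
  exact ⟨w, by simp [bracketLinear_apply, frobenius_bracket, hn0], n, hn, rfl⟩

theorem frobenius_mem_of_mem_baseSubrep {x : cInd W.toRepresentation}
    (hx : x ∈ (baseSubrep ρ α hH W).toSubmodule) : frobenius hH ρ W x ∈ W.toSubmodule := by
  obtain ⟨w, hw, -⟩ := exists_bracket_add_of_mem_baseSubrep hx
  exact hw ▸ w.2

theorem mem_edgeSubrep_of_mem_baseSubrep {x : cInd W.toRepresentation}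
    (hx : x ∈ (baseSubrep ρ α hH W).toSubmodule) (hx0 : frobenius hH ρ W x = 0) :
    x ∈ (edgeSubrep ρ α hH W).toSubmodule := by
  obtain ⟨w, hw, n, hn, rfl⟩ := exists_bracket_add_of_mem_baseSubrep hx
  obtain rfl : w = 0 := Subtype.ext (hw.trans hx0)
  simpa [← bracketLinear_apply] using hn

theorem cIndRep_mem_baseSubrep {x : cInd W.toRepresentation}
    (hx : x ∈ (baseSubrep ρ α hH W).toSubmodule) {a : G} (ha : a ∈ ({α, α⁻¹} : Set G))
    (hax : ρ a (frobenius hH ρ W x) ∈ W.toSubmodule) :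
    cIndRep W.toRepresentation a x ∈ (baseSubrep ρ α hH W).toSubmodule := by
  obtain ⟨w, hw, n, hn, rfl⟩ := exists_bracket_add_of_mem_baseSubrep hx
  rw [← hw] at hax
  have edge := bracket_sub_bracket_mem_edgeSubrep hH W ha (y := ⟨ρ a w, hax⟩) rfl
  rw [map_add, cIndRep_bracket, mul_one,
    ← add_sub_cancel (bracket hH W.toRepresentation 1 ⟨ρ a w, hax⟩) (bracket hH _ a w), add_assoc]
  exact Submodule.add_mem_sup ⟨_, rfl⟩
    (add_mem edge ((edgeSubrep ρ α hH W).apply_mem_toSubmodule a hn))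

end EdgeRelations

section Balls

open Filter Representation

variable {k G V : Type*} [Field k] [Group G] [AddCommGroup V] [Module k V]
  {ρ : Representation k G V} {H : Subgroup G} {α : G} (W : Subrepresentation (res ρ H))

variable (α) in
/-- The `H`-stable subspaces spanned by the vectors at distance at most `n` from `W`, where one step
applies an element of `H`, `H α H` or `H α⁻¹ H`. -/
def ballSubrep : ℕ → Subrepresentation (res ρ H)
  | 0 => W
  | n + 1 =>
    let U := (ballSubrep n).toSubmodule
    generatedSubrep (res ρ H) ((U ⊔ U.map (ρ α) ⊔ U.map (ρ α⁻¹) : Submodule k V) : Set V)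

theorem ballSubrep_le_succ (n : ℕ) : ballSubrep α W n ≤ ballSubrep α W (n + 1) := fun _ hv =>
  subset_gspan _ (Submodule.mem_sup_left (Submodule.mem_sup_left hv))

theorem ballSubrep_mono : Monotone (ballSubrep α W) :=
  monotone_nat_of_le_succ (ballSubrep_le_succ W)

theorem le_ballSubrep (n : ℕ) : W ≤ ballSubrep α W n := ballSubrep_mono W n.zero_le

theorem apply_mem_ballSubrep_succ {n : ℕ} {a : G} (ha : a ∈ ({α, α⁻¹} : Set G)) {v : V}
    (hv : v ∈ ballSubrep α W n) : ρ a v ∈ ballSubrep α W (n + 1) := by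
  refine subset_gspan _ ?_
  obtain rfl | rfl := ha
  · exact Submodule.mem_sup_left (Submodule.mem_sup_right ⟨v, hv, rfl⟩)
  · exact Submodule.mem_sup_right ⟨v, hv, rfl⟩

theorem ballSubrep_succ_le {n : ℕ} {L : Subrepresentation (res ρ H)} (hL : ballSubrep α W n ≤ L)
    (hLα : ∀ a ∈ ({α, α⁻¹} : Set G), ∀ v ∈ ballSubrep α W n, ρ a v ∈ L) :
    ballSubrep α W (n + 1) ≤ L := by
  have map_le (a : G) (ha : a ∈ ({α, α⁻¹} : Set G)) :
      (ballSubrep α W n).toSubmodule.map (ρ a) ≤ L.toSubmodule :=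
    Submodule.map_le_iff_le_comap.2 (hLα a ha)
  exact gspan_le (ρ := res ρ H) L.apply_mem_toSubmodule
    (sup_le (α := Submodule k V) (sup_le hL (map_le α (.inl rfl))) (map_le α⁻¹ (.inr rfl)))

theorem finiteDimensional_ballSubrep (h : IsLocallyFinite (res ρ H))
    [FiniteDimensional k W.toSubmodule] (n : ℕ) :
    FiniteDimensional k (ballSubrep α W n).toSubmodule := by
  induction n with
  | zero => assumption
  | succ n ih =>
    let U := (ballSubrep α W n).toSubmodule
    exact h.finiteDimensional_gspan_submodule (U ⊔ U.map (ρ α) ⊔ U.map (ρ α⁻¹))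

variable [TopologicalSpace G] [IsTopologicalGroup G] [IsSmooth ρ] (hH : IsOpen (H : Set G))

variable (α) in
/-- The morphism of compact inductions induced by the inclusion of `W` into `ballSubrep α W n`. -/
def toBall (n : ℕ) :
    (cIndRep W.toRepresentation).IntertwiningMap (cIndRep (ballSubrep α W n).toRepresentation) :=
  cIndMap (restrictHom (IntertwiningMap.id ρ) fun _ hw => le_ballSubrep W n hw)

theorem frobenius_toBall (n : ℕ) (f : cInd W.toRepresentation) :
    frobenius hH ρ (ballSubrep α W n) (toBall α W n f) = frobenius hH ρ W f :=
  DFunLike.congr_fun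
    (frobeniusHom_comp_cIndMap hH (IntertwiningMap.id ρ) fun _ hw => le_ballSubrep W n hw) f

theorem toBall_bracket (n : ℕ) (g : G) {w : V} (hw : w ∈ W.toSubmodule) :
    toBall α W n (bracket hH W.toRepresentation g ⟨w, hw⟩) =
      bracket hH (ballSubrep α W n).toRepresentation g ⟨w, le_ballSubrep W n hw⟩ :=
  cIndMap_bracket _ hH g _

/-- If `R` contains the edge relations, then `{w | [1, w] ∈ R}` is stable under those steps by
`α` and `α⁻¹` that stay in the ball, so it contains the whole ball once it contains `W`. -/
theorem eq_top_of_edgeSubrep_le {m : ℕ}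
    {R : Subrepresentation (cIndRep (ballSubrep α W m).toRepresentation)}
    (hedge : edgeSubrep ρ α hH (ballSubrep α W m) ≤ R) (hW : ∀ f, toBall α W m f ∈ R.toSubmodule) :
    R.toSubmodule = ⊤ := by
  let U := ballSubrep α W m
  let L : Subrepresentation (res ρ H) :=
    { toSubmodule := (R.toSubmodule.comap (bracketLinear hH U.toRepresentation 1)).map
        U.toSubmodule.subtype
      apply_mem_toSubmodule := by
        rintro h _ ⟨w, hw, rfl⟩
        refine ⟨U.toRepresentation h w, ?_, rfl⟩
        have := R.apply_mem_toSubmodule h hw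
        rwa [bracketLinear_apply, cIndRep_bracket_one_of_mem] at this }
  have ball_le (n : ℕ) (hn : n ≤ m) : ballSubrep α W n ≤ L := by
    induction n with
    | zero =>
      refine fun w hw => ⟨⟨w, le_ballSubrep W m hw⟩, ?_, rfl⟩
      have := hW (bracket hH W.toRepresentation 1 ⟨w, hw⟩)
      rwa [toBall_bracket W hH m 1 hw] at this
    | succ n ih =>
      refine ballSubrep_succ_le W (ih (by omega)) fun a ha v hv => ?_
      obtain ⟨w, hw, rfl⟩ := ih (by omega) hv
      have haw : ρ a (w : V) ∈ U := ballSubrep_mono W hn (apply_mem_ballSubrep_succ W ha hv)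
      refine ⟨⟨ρ a w, haw⟩, ?_, rfl⟩
      have edge := hedge (bracket_sub_bracket_mem_edgeSubrep hH U ha (y := ⟨ρ a w, haw⟩) rfl)
      rw [bracket_eq_cIndRep] at edge
      exact (R.toSubmodule.sub_mem_iff_right (R.apply_mem_toSubmodule a hw)).1 edge
  refine eq_top_iff.2 fun f _ => mem_of_bracket_mem hH R.apply_mem_toSubmodule fun g => ?_
  obtain ⟨w, hw, hwf⟩ := ball_le m le_rfl (f.1 g).2
  exact (Subtype.ext hwf : w = f.1 g) ▸ hw

theorem eventually_toBall_mem_baseSubrep (hα : H ⊔ Subgroup.zpowers α = ⊤)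
    (f : cInd W.toRepresentation) :
    ∀ᶠ n in atTop, toBall α W n f ∈ (baseSubrep ρ α hH (ballSubrep α W n)).toSubmodule := by
  let P : Submodule k (cInd W.toRepresentation) :=
    { carrier := {f | ∀ᶠ n in atTop,
        toBall α W n f ∈ (baseSubrep ρ α hH (ballSubrep α W n)).toSubmodule}
      zero_mem' := .of_forall fun n => by rw [map_zero]; exact zero_mem _
      add_mem' := fun ha hb => by
        filter_upwards [ha, hb] with n hna hnb
        rw [map_add]; exact add_mem hna hnb
      smul_mem' := fun c f hf => by
        filter_upwards [hf] with n hn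
        rw [map_smul]; exact Submodule.smul_mem _ c hn }
  have P_stable : ∀ g : G, ∀ f ∈ P, cIndRep W.toRepresentation g f ∈ P := by
    intro g f hf
    refine apply_mem_of_sup_zpowers_eq_top hα (fun h hh f hf => ?_) (fun a ha f hf => ?_) g hf
    · filter_upwards [hf] with n hn
      rw [IntertwiningMap.isIntertwining]
      exact (baseSubrep ρ α hH (ballSubrep α W n)).apply_mem_toSubmodule ⟨h, hh⟩ hn
    · obtain ⟨n, hn⟩ := Eventually.exists hf
      have frobenius_mem : frobenius hH ρ W f ∈ ballSubrep α W n :=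
        frobenius_toBall W hH n f ▸ frobenius_mem_of_mem_baseSubrep hn
      filter_upwards [hf, eventually_ge_atTop (n + 1)] with m hm hnm
      rw [IntertwiningMap.isIntertwining]
      refine cIndRep_mem_baseSubrep hm ha ?_
      rw [frobenius_toBall]
      exact ballSubrep_mono W hnm (apply_mem_ballSubrep_succ W ha frobenius_mem)
  refine mem_of_bracket_mem (P := P) hH P_stable fun g => .of_forall fun n => ?_
  rw [toBall_bracket]
  exact Submodule.mem_sup_left ⟨_, rfl⟩

theorem exists_edgeSubrep_ballSubrep_eq_ker (hα : H ⊔ Subgroup.zpowers α = ⊤)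
    (hfin : IsFinGen (cIndRep W.toRepresentation) (LinearMap.ker (frobenius hH ρ W))) :
    ∃ n, (edgeSubrep ρ α hH (ballSubrep α W n)).toSubmodule =
      LinearMap.ker (frobenius hH ρ (ballSubrep α W n)) := by
  obtain ⟨S, hS, hS_ker⟩ := hfin
  obtain ⟨n, hn⟩ := ((eventually_all_finite hS).2 fun f _ =>
    eventually_toBall_mem_baseSubrep W hH hα f).exists
  have toBall_ker_mem : ∀ f ∈ LinearMap.ker (frobenius hH ρ W),
      toBall α W n f ∈ (edgeSubrep ρ α hH (ballSubrep α W n)).toSubmodule := by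
    have le_comap : gspan (cIndRep W.toRepresentation) S ≤
        (edgeSubrep ρ α hH (ballSubrep α W n)).toSubmodule.comap (toBall α W n).toLinearMap := by
      refine gspan_le (fun g f hf => ?_) fun f hf => ?_
      · rw [Submodule.mem_comap, IntertwiningMap.coe_toLinearMap, (toBall α W n).isIntertwining]
        exact (edgeSubrep ρ α hH (ballSubrep α W n)).apply_mem_toSubmodule g hf
      · have hf0 : f ∈ LinearMap.ker (frobenius hH ρ W) := hS_ker ▸ subset_gspan S hf
        exact mem_edgeSubrep_of_mem_baseSubrep (hn f hf) ((frobenius_toBall W hH n f).trans hf0)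
    exact fun f hf => le_comap (hS_ker ▸ hf)
  have sup_range : (edgeSubrep ρ α hH (ballSubrep α W n) ⊔ (toBall α W n).range).toSubmodule = ⊤ :=
    eq_top_of_edgeSubrep_le W hH le_sup_left fun f => Submodule.mem_sup_right ⟨f, rfl⟩
  refine ⟨n, le_antisymm (edgeSubrep_le_ker_frobenius hH _) fun f hf => ?_⟩
  obtain ⟨x, hx, _, ⟨e, rfl⟩, rfl⟩ := Submodule.mem_sup.1 (sup_range ▸ Submodule.mem_top (x := f))
  refine add_mem hx (toBall_ker_mem e ?_)
  have hx0 : frobenius hH ρ _ x = 0 := edgeSubrep_le_ker_frobenius hH _ hx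
  have hf0 : frobenius hH ρ _ (x + toBall α W n e) = 0 := hf
  rwa [map_add, hx0, zero_add, frobenius_toBall] at hf0

end Balls

section Generation

open Matrix (GeneralLinearGroup SpecialLinearGroup)

variable {n R : Type*} [Fintype n] [DecidableEq n] [CommRing R]

/-- The diagonal matrices of `GL n R`, as a group homomorphism from `n → Rˣ`. -/
def diagHom : (n → Rˣ) →* GL n R :=
  (Units.map (Matrix.diagonalRingHom n R).toMonoidHom).comp
    (MulEquiv.piUnits (M := fun _ : n => R)).symm.toMonoidHom

theorem coe_diagHom (d : n → Rˣ) :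
    (diagHom d : Matrix n n R) = Matrix.diagonal fun i => (d i : R) := rfl

theorem diagHom_const_mem_center (c : Rˣ) :
    diagHom (fun _ : n => c) ∈ Subgroup.center (GL n R) :=
  GeneralLinearGroup.mem_center_iff_val_mem_range_scalar.2 ⟨c, rfl⟩

theorem map_diagHom {S : Type*} [CommRing S] (f : R →+* S) (d : n → Rˣ) :
    GeneralLinearGroup.map f (diagHom d) = diagHom fun i => Units.map f (d i) :=
  Units.ext (Matrix.diagonal_map (map_zero f))

theorem diagHom_conj_transvection (d : n → Rˣ) {i j : n} (hij : i ≠ j) (c : R) :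
    diagHom d * (SpecialLinearGroup.transvection hij c).toGL * (diagHom d)⁻¹ =
      (SpecialLinearGroup.transvection hij (d i * c * ↑(d j)⁻¹)).toGL := by
  rw [mul_inv_eq_iff_eq_mul]
  refine Units.ext ?_
  suffices Matrix.diagonal (fun i => (d i : R)) * Matrix.single i j c =
      Matrix.single i j (d i * c * ↑(d j)⁻¹) * Matrix.diagonal (fun i => (d i : R)) by
    simp [coe_diagHom, SpecialLinearGroup.transvection_coe, mul_add, add_mul, this]
  ext a b
  rw [Matrix.diagonal_mul, Matrix.mul_diagonal, Matrix.single_apply, Matrix.single_apply]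
  split_ifs with hab
  · obtain ⟨rfl, rfl⟩ := hab
    simp
  · simp

theorem map_transvection_one {S : Type*} [CommRing S] (f : R →+* S) {i j : n} (hij : i ≠ j) :
    GeneralLinearGroup.map f (SpecialLinearGroup.transvection hij 1).toGL =
      (SpecialLinearGroup.transvection hij 1).toGL := by
  refine Units.ext ?_
  change (1 + Matrix.single i j (1 : R)).map f = 1 + Matrix.single i j 1
  simp [Matrix.map_add]

variable {E : Type*} [Field E] {S : Subgroup (GL n E)}

theorem transvection_mem_of_diagHom_mem (hdiag : ∀ d, diagHom d ∈ S) {i j : n} (hij : i ≠ j)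
    (hone : (SpecialLinearGroup.transvection hij 1).toGL ∈ S) (c : E) :
    (SpecialLinearGroup.transvection hij c).toGL ∈ S := by
  rcases eq_or_ne c 0 with rfl | hc
  · rw [SpecialLinearGroup.transvection_coeff_zero, map_one]
    exact S.one_mem
  · have conj := diagHom_conj_transvection (Pi.mulSingle i (Units.mk0 c hc)) hij 1
    rw [Pi.mulSingle_eq_same, Pi.mulSingle_eq_of_ne hij.symm, inv_one, Units.val_one, mul_one,
      mul_one, Units.val_mk0] at conj
    exact conj ▸ S.mul_mem (S.mul_mem (hdiag _) hone) (S.inv_mem (hdiag _))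

theorem eq_top_of_diagHom_mem_of_transvection_mem (hdiag : ∀ d, diagHom d ∈ S)
    (htrans : ∀ (i j : n) (hij : i ≠ j), (SpecialLinearGroup.transvection hij 1).toGL ∈ S) :
    S = ⊤ := by
  refine eq_top_iff.2 fun g _ => ?_
  suffices ∀ g' : GL n E, (g' : Matrix n n E) = g → g' ∈ S from this g rfl
  refine Matrix.diagonal_transvection_induction_of_det_ne_zero
    (fun A => ∀ g' : GL n E, (g' : Matrix n n E) = A → g' ∈ S) g g.det_ne_zero ?_ ?_ ?_
  · intro D hD g' hg'
    rw [Matrix.det_diagonal, Finset.prod_ne_zero_iff] at hD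
    have : g' = diagHom fun i => Units.mk0 (D i) (hD i (Finset.mem_univ i)) := Units.ext hg'
    exact this ▸ hdiag _
  · rintro ⟨i, j, hij, c⟩ g' hg'
    obtain rfl : g' = (SpecialLinearGroup.transvection hij c).toGL := Units.ext hg'
    exact transvection_mem_of_diagHom_mem hdiag hij (htrans i j hij) c
  · intro A B hA hB ihA ihB g' hg'
    have : g' = GeneralLinearGroup.mkOfDetNeZero A hA * GeneralLinearGroup.mkOfDetNeZero B hB :=
      Units.ext hg'
    exact this ▸ S.mul_mem (ihA _ rfl) (ihB _ rfl)

end Generation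

section GL2

open Matrix (GeneralLinearGroup SpecialLinearGroup)

variable {F : Type*} [Field F] [ValuativeRel F]

theorem diagUnif_eq_diagHom (ϖ : 𝒪[F]) (hϖ : Irreducible ϖ) : diagUnif ϖ hϖ =
    diagHom (Pi.mulSingle 0 (Units.mk0 (ϖ : F) (by simpa using hϖ.ne_zero))) := by
  ext i j
  fin_cases i <;> fin_cases j <;> simp [diagUnif, coe_diagHom]

variable [TopologicalSpace F] [IsNonarchimedeanLocalField F]

theorem units_eq_top_of_uniformizer {ϖ : 𝒪[F]} (hϖ : Irreducible ϖ) {T : Subgroup Fˣ}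
    (hT : ∀ u : 𝒪[F]ˣ, Units.map (algebraMap 𝒪[F] F : 𝒪[F] →* F) u ∈ T)
    (hϖT : Units.mk0 (ϖ : F) (by simpa using hϖ.ne_zero) ∈ T) : T = ⊤ := by
  have mem_of_integral (a : Fˣ) (ha : (a : F) ∈ 𝒪[F]) : a ∈ T := by
    have ne_zero : (⟨a, ha⟩ : 𝒪[F]) ≠ 0 := fun h => a.ne_zero (congrArg Subtype.val h)
    obtain ⟨n, u, hu⟩ := IsDiscreteValuationRing.eq_unit_mul_pow_irreducible ne_zero hϖ
    have : a = Units.map (algebraMap 𝒪[F] F : 𝒪[F] →* F) u *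
        Units.mk0 (ϖ : F) (by simpa using hϖ.ne_zero) ^ n :=
      Units.ext (congrArg Subtype.val hu)
    exact this ▸ T.mul_mem (hT u) (T.pow_mem hϖT n)
  refine eq_top_iff.2 fun a _ => ?_
  rcases le_total (ValuativeRel.valuation F (a : F)) 1 with ha | ha
  · exact mem_of_integral a ha
  · refine inv_inv a ▸ T.inv_mem (mem_of_integral a⁻¹ ?_)
    change ValuativeRel.valuation F ((a⁻¹ : Fˣ) : F) ≤ 1
    rw [Units.val_inv_eq_inv_val, map_inv₀]
    exact inv_le_one_of_one_le₀ ha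

theorem KZ_sup_zpowers_diagUnif (ϖ : 𝒪[F]) (hϖ : Irreducible ϖ) :
    KZ F ⊔ Subgroup.zpowers (diagUnif ϖ hϖ) = ⊤ := by
  set S := KZ F ⊔ Subgroup.zpowers (diagUnif ϖ hϖ)
  have K_le : K F ≤ S := le_sup_left.trans le_sup_left
  have center_le : Subgroup.center (GL (Fin 2) F) ≤ S := le_sup_right.trans le_sup_left
  have comap_eq_top : S.comap (diagHom.comp (MonoidHom.mulSingle (fun _ => Fˣ) 0)) = ⊤ := by
    refine units_eq_top_of_uniformizer hϖ (fun u => K_le ⟨diagHom (Pi.mulSingle 0 u), ?_⟩) ?_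
    · rw [map_diagHom]
      exact congrArg diagHom (Pi.mulSingle_op (fun _ => Units.map (algebraMap 𝒪[F] F : 𝒪[F] →* F))
        (fun _ => map_one _) 0 u).symm
    · rw [Subgroup.mem_comap, MonoidHom.comp_apply, MonoidHom.mulSingle_apply,
        ← diagUnif_eq_diagHom ϖ hϖ]
      exact le_sup_right (a := KZ F) (Subgroup.mem_zpowers _)
  refine eq_top_of_diagHom_mem_of_transvection_mem (fun d => ?_) fun i j hij =>
    K_le ⟨_, map_transvection_one (algebraMap 𝒪[F] F) hij⟩
  have factorization : d = Pi.mulSingle 0 (d 0 / d 1) * fun _ => d 1 := by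
    ext i
    fin_cases i <;> simp
  rw [factorization, map_mul]
  refine S.mul_mem ?_ (center_le (diagHom_const_mem_center (d 1)))
  exact (comap_eq_top ▸ Subgroup.mem_top (d 0 / d 1) :)

theorem isCompact_K : IsCompact (K F : Set (GL (Fin 2) F)) := by
  have : CompactSpace (Matrix (Fin 2) (Fin 2) 𝒪[F]) :=
    inferInstanceAs (CompactSpace (Fin 2 → Fin 2 → 𝒪[F]))
  have : T0Space F :=
    letI := IsTopologicalAddGroup.rightUniformSpace F
    haveI := isUniformAddGroup_of_addCommGroup (G := F)
    inferInstance
  have : CompactSpace (GL (Fin 2) 𝒪[F]) :=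
    inferInstanceAs (CompactSpace (Matrix (Fin 2) (Fin 2) 𝒪[F])ˣ)
  refine isCompact_range (f := GeneralLinearGroup.map (n := Fin 2) (algebraMap 𝒪[F] F))
    (Continuous.units_map ((algebraMap 𝒪[F] F).mapMatrix (m := Fin 2)).toMonoidHom ?_)
  exact continuous_id.matrix_map continuous_subtype_val

variable {k V : Type*} [Field k] [AddCommGroup V] [Module k V]
  {ρ : Representation k (GL (Fin 2) F) V}

theorem isLocallyFinite_res_KZ [IsSmooth ρ] (hZ : HasCentralCharacter ρ) :
    IsLocallyFinite (res ρ (KZ F)) :=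
  have : CompactSpace (K F) := isCompact_iff_compactSpace.1 isCompact_K
  (isLocallyFinite_of_compactSpace (res ρ (K F))).res_sup_center hZ

theorem hasCentralCharacter_cIndRep (hZ : HasCentralCharacter ρ)
    (W : Subrepresentation (res ρ (KZ F))) :
    HasCentralCharacter (cIndRep W.toRepresentation) := by
  obtain ⟨χ, hχ⟩ := hZ
  exact ⟨χ, fun z => cIndRep_apply_of_mem_center z.2 (le_sup_right (a := K F) z.2)
    fun v => Subtype.ext (hχ z v)⟩

variable [IsSmooth ρ]

theorem genSubspaces_nonempty (hZ : HasCentralCharacter ρ) (hfg : IsFinGen ρ ⊤) :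
    (genSubspaces ρ).Nonempty := by
  obtain ⟨S, hS, hSV⟩ := hfg
  exact ⟨generatedSubrep (res ρ (KZ F)) S, (isLocallyFinite_res_KZ hZ).finiteDimensional_gspan hS,
    top_le_iff.1 (hSV ▸ gspan_mono (subset_gspan S))⟩

theorem IsFinitePresentation.of_mem_genSubspaces (hZ : HasCentralCharacter ρ)
    {W W' : Subrepresentation (res ρ (KZ F))} (hW : W ∈ genSubspaces ρ)
    (hW' : W' ∈ genSubspaces ρ) (h : IsFinitePresentation ρ W) : IsFinitePresentation ρ W' := by
  have := hW.1
  have := hW'.1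
  have := isSmooth_cIndRep (σ := W'.toRepresentation) (isOpen_KZ F)
  exact isFinGen_ker_of_isFinGen_ker_frobenius (isOpen_KZ F)
    (frobeniusHom_surjective (isOpen_KZ F) ρ W' hW'.2) (isFinGen_cIndRep (isOpen_KZ F))
    (isLocallyFinite_res_KZ (hasCentralCharacter_cIndRep hZ W')) W hW.2 h

variable {ϖ : 𝒪[F]} {hϖ : Irreducible ϖ}

theorem IsStandardPresentation.isFinitePresentation {W : Subrepresentation (res ρ (KZ F))}
    (hW : FiniteDimensional k W.toSubmodule) (h : IsStandardPresentation ϖ hϖ ρ W) :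
    IsFinitePresentation ρ W := by
  rw [IsFinitePresentation, ← h]
  exact isFinGen_edgeSubrep (isOpen_KZ F) W

theorem AdmitsFinitePresentation.admitsStandardPresentation (hZ : HasCentralCharacter ρ)
    (h : AdmitsFinitePresentation ρ) : AdmitsStandardPresentation ϖ hϖ ρ := by
  obtain ⟨W, ⟨hW, hWV⟩, hfin⟩ := h
  obtain ⟨n, hn⟩ := exists_edgeSubrep_ballSubrep_eq_ker W (isOpen_KZ F)
    (KZ_sup_zpowers_diagUnif ϖ hϖ) hfin
  exact ⟨ballSubrep (diagUnif ϖ hϖ) W n,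
    ⟨finiteDimensional_ballSubrep W (isLocallyFinite_res_KZ hZ) n,
      top_le_iff.1 (hWV ▸ gspan_mono (le_ballSubrep W n))⟩, hn⟩

end GL2

end ModPRep

end

theorem mainTheorem9_general
    (F : Type*) [Field F] [ValuativeRel F] [TopologicalSpace F] [IsNonarchimedeanLocalField F]
    (ϖ : 𝒪[F]) (hϖ : Irreducible ϖ) (k : Type*) [Field k]
    (V : Type*) [AddCommGroup V] [Module k V]
    (ρ : Representation k (GL (Fin 2) F) V) [ModPRep.IsSmooth ρ]
    (hZ : ModPRep.HasCentralCharacter ρ) (hfg : ModPRep.IsFinGen ρ ⊤) :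
    (ModPRep.AdmitsFinitePresentation ρ ↔ ModPRep.AdmitsStandardPresentation ϖ hϖ ρ) ∧
    (ModPRep.AdmitsFinitePresentation ρ ↔
      ∀ W ∈ ModPRep.genSubspaces ρ, ModPRep.IsFinitePresentation ρ W) := by
  refine ⟨⟨fun h => h.admitsStandardPresentation hZ, ?_⟩, ?_, fun h => ?_⟩
  · rintro ⟨W, hW, h⟩
    exact ⟨W, hW, h.isFinitePresentation hW.1⟩
  · rintro ⟨W, hW, h⟩ W' hW'
    exact h.of_mem_genSubspaces hZ hW hW'
  · obtain ⟨W, hW⟩ := ModPRep.genSubspaces_nonempty hZ hfg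
    exact ⟨W, hW, h W hW⟩

theorem mainTheorem9 (p : ℕ) [Fact p.Prime]
    (F : Type*) [Field F] [ValuativeRel F] [TopologicalSpace F] [IsNonarchimedeanLocalField F]
    [CharP 𝓀[F] p] (ϖ : 𝒪[F]) (hϖ : Irreducible ϖ)
    (k : Type*) [Field k] [IsAlgClosed k] [CharP k p]
    (V : Type*) [AddCommGroup V] [Module k V]
    (ρ : Representation k (GL (Fin 2) F) V) [ModPRep.IsSmooth ρ]
    (hZ : ModPRep.HasCentralCharacter ρ) (hfg : ModPRep.IsFinGen ρ ⊤) :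
    (ModPRep.AdmitsFinitePresentation ρ ↔ ModPRep.AdmitsStandardPresentation ϖ hϖ ρ) ∧
    (ModPRep.AdmitsFinitePresentation ρ ↔
      ∀ W ∈ ModPRep.genSubspaces ρ, ModPRep.IsFinitePresentation ρ W) :=
  mainTheorem9_general F ϖ hϖ k V ρ hZ hfg
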